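/- Let $q$ be a power of an odd prime $p$ (with $p=3$ allowed) such that $q\equiv 3 \pmod 4$, and let $a\in\mathbb F_q^*$. Let $\phi$ be the quadratic character of $\mathbb F_q$ (with $\phi(0)=0$), let $\psi(y)=\exp\big(\tfrac{2\pi i}{p}\operatorname{Tr}_{\mathbb F_q/\mathbb F_p}(y)\big)$ and $\psi_2(z)=\exp\big(\tfrac{2\pi i}{p}\operatorname{Tr}_{\mathbb F_{q^2}/\mathbb F_p}(z)\big)$ be the canonical additive characters of $\mathbb F_q$ and $\mathbb F_{q^2}$, and let $G(\phi)=\sum_{y\in\mathbb F_q}\phi(y)\psi(y)$. Let $M_8$ be a multiplicative character of $\mathbb F_{q^2}$ of exact order $8$ with values in $\mathbb C$ (with $M_8(0)=0$), let $N(z)=z^{q+1}$ be the norm from $\mathbb F_{q^2}$ to $\mathbb F_q$, and let $\tau\in\mathbb C$ satisfy $\tau^2=q\,M_8(-a)$. For $j,k\in\mathbb F_q$ put $$P(j,k)=\delta(j,k)+\phi(-1)\,\delta(j,-k)+\frac1{G(\phi)}\sum_{x\in\mathbb F_q^*}\phi\!\left(\frac ax-x\right)\psi\!\left(x(j+k)^2+\frac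 ax(j-k)^2\right),$$ where $\delta$ is the Kronecker delta, and $$V(j)=\tau^{-1}\phi(j)\sum_{\substack{z\in\mathbb F_{q^2}\\ N(z)=a}}M_8(z)\,\psi_2(j^2z).$$ Then $P(j,k)=V(j)V(k)$ for all $j,k\in\mathbb F_q$. -/

import Mathlib

open scoped BigOperators

noncomputable section

namespace KatzSums

/-- The canonical additive character `y ↦ exp (2 π i Tr(y) / p)` of a finite field `F` of
characteristic `p`, where `Tr(y) = y^p + y^(p^2) + ⋯ + y^(#F)` is the trace to the prime field.
It serves as `ψ` on `𝔽_q` and as `ψ₂` on `𝔽_{q²}`. -/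
def psi (p : ℕ) [Fact p.Prime] (F : Type*) [Field F] [Algebra (ZMod p) F] : AddChar F ℂ :=
  (ZMod.stdAddChar (N := p)).compAddMonoidHom (Algebra.trace (ZMod p) F).toAddMonoidHom

/-- The quadratic character of `F`, with complex values and `φ(0) = 0`. -/
def phi (F : Type*) [Field F] [Fintype F] [DecidableEq F] : MulChar F ℂ :=
  (quadraticChar F).ringHomComp (Int.castRingHom ℂ)

/-- The mixed exponential sum
`P(j,k) = δ(j,k) + φ(-1) δ(j,-k)
  + G(φ)⁻¹ ∑_{x ≠ 0} φ(a/x - x) ψ(x (j+k)² + (a/x) (j-k)²)`. -/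
def P (p : ℕ) [Fact p.Prime] {F : Type*} [Field F] [Fintype F] [DecidableEq F]
    [Algebra (ZMod p) F] (a j k : F) : ℂ :=
  (if j = k then 1 else 0) + phi F (-1) * (if j = -k then 1 else 0) +
    1 / gaussSum (phi F) (psi p F) *
      ∑ x : F with x ≠ 0,
        phi F (a / x - x) * psi p F (x * (j + k) ^ 2 + (a / x) * (j - k) ^ 2)

/-- The norm-restricted Gauss sum
`V(j) = τ⁻¹ φ(j) ∑_{z ∈ K, N z = a} M₈(z) ψ₂(j² z)`, where `N` is the norm from `K` to `F`. -/
def V (p : ℕ) [Fact p.Prime] {F K : Type*} [Field F] [Fintype F] [DecidableEq F]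
    [Field K] [Fintype K] [Algebra F K] [Algebra (ZMod p) K]
    (M₈ : MulChar K ℂ) (τ : ℂ) (a j : F) : ℂ :=
  τ⁻¹ * phi F j *
    ∑ z : K with Algebra.norm F z = a, M₈ z * psi p K (algebraMap F K j ^ 2 * z)

end KatzSums

end

/-! Both sides are averages of Kloosterman sums `kl ψ n`, and a Gaussian summation matches the two
averages. If jk = 0, both sides vanish. In V(j)V(k), write the second variable as w = s·z̄ with N(s)
= 1. This pulls out M₈(a)M₈(s), and the inner sum over N(z) = a is -kl(a·N(j² + k²s̄)), plus q
exactly when j² = k² and s = -1 (`sum_norm_mul_sum_norm`); that exception produces the delta terms.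
The norm depends on s only through Tr s + 2. Putting s = r², where Tr s + 2 = (Tr r)² and M₈(r)² =
φ(Tr r + 2) for r ≠ -1, turns the sum over the norm-one circle into φ(2) ∑ φ(t+1) f(4t²)
(`sum_norm_one_apply`). Order 8 and q ≡ 3 mod 4 enter here. In P, opening φ(a/x - x) with the Gauss
sum gives ∑ φ(m) kl(a(B-m)(A+m)), where A = (j-k)² and B = (j+k)² (`gaussSum_mul_sum_phi_sub`).
Completing a square in `sum_phi_add_mul_kl` identifies the two averages; G(φ)² = -q and M₈(-1) =
φ(2) settle the constants. -/

namespace KatzSums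

/-! ### Quadratic character, Gauss sums and Kloosterman sums over the base field. -/

section BaseField

variable {F : Type*} [Field F] [Fintype F]

theorem two_ne_zero_of_card (hq : Fintype.card F % 4 = 3) : (2 : F) ≠ 0 := by
  intro h
  have h2 : ringChar F = 2 := by
    have : ringChar F ∣ 2 := (ringChar.spec F 2).1 (by exact_mod_cast h)
    exact (Nat.prime_two.eq_one_or_self_of_dvd _ this).resolve_left
      (fun h1 => CharP.ringChar_ne_one h1)
  have := FiniteField.even_card_of_char_two h2
  omega

theorem ringChar_ne_two (hq : Fintype.card F % 4 = 3) : ringChar F ≠ 2 := by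
  intro h2
  have := FiniteField.even_card_of_char_two h2
  omega

theorem four_ne_zero_of_card (hq : Fintype.card F % 4 = 3) : (4 : F) ≠ 0 := by
  have h2 := two_ne_zero_of_card hq
  have : (4 : F) = 2 * 2 := by norm_num
  rw [this]; exact mul_ne_zero h2 h2

theorem sum_univ_mul {c : F} (hc : c ≠ 0) (f : F → ℂ) : ∑ x, f (c * x) = ∑ x, f x :=
  Fintype.sum_bijective _ (mulLeft_bijective₀ c hc) _ _ fun _ => rfl

variable [DecidableEq F]

theorem phi_apply (x : F) : phi F x = ((quadraticChar F x : ℤ) : ℂ) := rfl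

theorem phi_zero : phi F 0 = 0 := by simp [phi_apply]

theorem phi_sq {x : F} (hx : x ≠ 0) : phi F (x ^ 2) = 1 := by
  rw [phi_apply, quadraticChar_sq_one' hx]; simp

theorem phi_mul_self {x : F} (hx : x ≠ 0) : phi F x * phi F x = 1 := by
  rw [← map_mul, ← sq, phi_sq hx]

theorem phi_eq_one_or {x : F} (hx : x ≠ 0) : phi F x = 1 ∨ phi F x = -1 :=
  mul_self_eq_one_iff.1 (phi_mul_self hx)

theorem phi_neg_one (hq : Fintype.card F % 4 = 3) : phi F (-1) = -1 := by
  have : ¬ IsSquare (-1 : F) := by rw [FiniteField.isSquare_neg_one_iff]; simpa using hq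
  rw [phi_apply, quadraticChar_neg_one_iff_not_isSquare.2 this]; simp

theorem phi_neg (hq : Fintype.card F % 4 = 3) (x : F) : phi F (-x) = -phi F x := by
  rw [← neg_one_mul, map_mul, phi_neg_one hq, neg_one_mul]

theorem phi_ne_one (hq : Fintype.card F % 4 = 3) : phi F ≠ 1 := by
  intro h
  have h1 := phi_neg_one hq
  rw [h, MulChar.one_apply (by simp)] at h1
  norm_num at h1

theorem gaussSum_phi_sq (hq : Fintype.card F % 4 = 3) {ψ : AddChar F ℂ} (hψ : ψ.IsPrimitive) :
    gaussSum (phi F) ψ ^ 2 = -(Fintype.card F : ℂ) := by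
  rw [gaussSum_sq (phi_ne_one hq) ((quadraticChar_isQuadratic F).comp _) hψ, phi_neg_one hq,
    neg_one_mul]

theorem gaussSum_phi_ne_zero (hq : Fintype.card F % 4 = 3) {ψ : AddChar F ℂ}
    (hψ : ψ.IsPrimitive) : gaussSum (phi F) ψ ≠ 0 := by
  intro h
  have := gaussSum_phi_sq hq hψ
  rw [h, zero_pow two_ne_zero, zero_eq_neg] at this
  exact Fintype.card_ne_zero (by exact_mod_cast this)

theorem sum_sqrt_indicator (hq : Fintype.card F % 4 = 3) (d : F) :
    ∑ e : F, (if e ^ 2 = d then (1 : ℂ) else 0) = 1 + phi F d := by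
  have h := quadraticChar_card_sqrts (ringChar_ne_two hq) d
  rw [Finset.sum_boole, phi_apply]
  have h' : ((Finset.univ.filter fun e : F => e ^ 2 = d).card : ℤ) = quadraticChar F d + 1 := by
    rw [← h]; congr 2; ext; simp
  have h2 : (((Finset.univ.filter fun e : F => e ^ 2 = d).card : ℤ) : ℂ) =
    ((quadraticChar F d + 1 : ℤ) : ℂ) := by rw [h']
  push_cast at h2
  rw [h2]; ring

theorem sum_curve (hq : Fintype.card F % 4 = 3) (D : F → F) (f : F → ℂ) :
    ∑ p : F × F with p.2 ^ 2 = D p.1, f p.1 = ∑ y, (1 + phi F (D y)) * f y := by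
  rw [Finset.sum_filter, Fintype.sum_prod_type]
  refine Finset.sum_congr rfl fun y _ => ?_
  rw [← sum_sqrt_indicator hq, Finset.sum_mul]
  simp

theorem sum_sq (hq : Fintype.card F % 4 = 3) (f : F → ℂ) :
    ∑ t, f (t ^ 2) = ∑ y, (1 + phi F y) * f y := by
  simp_rw [← sum_sqrt_indicator hq, Finset.sum_mul]
  rw [Finset.sum_comm]
  simp

/-- Solving x + n/x = y is a quadratic equation of discriminant y² - 4n; the second coordinate x -
n/x is its square root. -/
theorem sum_add_div (hq : Fintype.card F % 4 = 3) {n : F} (hn : n ≠ 0) (f : F → ℂ) :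
    ∑ x : F with x ≠ 0, f (x + n / x) = ∑ y, (1 + phi F (y ^ 2 - 4 * n)) * f y := by
  have h2 := two_ne_zero_of_card hq
  have h4 := four_ne_zero_of_card hq
  rw [← sum_curve hq (fun y => y ^ 2 - 4 * n) f]
  refine Finset.sum_bij' (fun x _ => (x + n / x, x - n / x)) (fun p _ => (p.1 + p.2) / 2)
    ?_ ?_ ?_ ?_ ?_
  · intro x hx
    have hx : x ≠ 0 := by simpa using hx
    simp only [Finset.mem_filter, Finset.mem_univ, true_and]
    field_simp
    ring
  · rintro ⟨y, e⟩ hp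
    simp only [Finset.mem_filter, Finset.mem_univ, true_and] at hp ⊢
    intro h0
    have h0 : y + e = 0 := by
      rcases div_eq_zero_iff.1 h0 with h | h
      · exact h
      · exact absurd h h2
    have : 4 * n = 0 := by linear_combination (y - e) * h0 + hp
    exact (mul_ne_zero h4 hn) this
  · intro x hx
    have hx : x ≠ 0 := by simpa using hx
    simp only
    field_simp
    ring
  · rintro ⟨y, e⟩ hp
    simp only [Finset.mem_filter, Finset.mem_univ, true_and] at hp
    have h0 : y + e ≠ 0 := by
      intro h0
      have : 4 * n = 0 := by linear_combination (y - e) * h0 + hp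
      exact (mul_ne_zero h4 hn) this
    have hn' : n / ((y + e) / 2) = (y - e) / 2 := by
      field_simp
      linear_combination hp
    simp only [hn', Prod.mk.injEq]
    constructor <;> field_simp <;> ring
  · intro x _; rfl

/-- The Kloosterman sum `∑_{x ≠ 0} ψ(x + n/x)`. -/
noncomputable def kl (ψ : AddChar F ℂ) (n : F) : ℂ := ∑ x : F with x ≠ 0, ψ (x + n / x)

theorem sum_addChar_mul {ψ : AddChar F ℂ} (hψ : ψ.IsPrimitive) (b : F) :
    ∑ x : F, ψ (b * x) = if b = 0 then (Fintype.card F : ℂ) else 0 := by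
  have := AddChar.sum_mulShift b hψ
  simp_rw [mul_comm _ b] at this
  rw [this]; split_ifs <;> simp

theorem sum_ne_zero_eq (f : F → ℂ) : ∑ x : F with x ≠ 0, f x = ∑ x, f x - f 0 := by
  rw [Finset.filter_ne', ← Finset.add_sum_erase _ f (Finset.mem_univ 0)]; ring

theorem sum_ne_zero_inv (f : F → ℂ) : ∑ x : F with x ≠ 0, f x⁻¹ = ∑ x : F with x ≠ 0, f x :=
  Finset.sum_bij' (fun x _ => x⁻¹) (fun x _ => x⁻¹) (by simp) (by simp) (by simp) (by simp)
    (by simp)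

theorem sum_ne_zero_mul {c : F} (hc : c ≠ 0) (f : F → ℂ) :
    ∑ x : F with x ≠ 0, f (c * x) = ∑ x : F with x ≠ 0, f x :=
  Finset.sum_bij' (fun x _ => c * x) (fun x _ => c⁻¹ * x) (by simp [hc]) (by simp [hc])
    (by simp [hc]) (by simp [hc]) (by simp)

theorem kl_zero {ψ : AddChar F ℂ} (hψ : ψ.IsPrimitive) : kl ψ 0 = -1 := by
  have h := sum_addChar_mul hψ 1
  simp only [one_mul, one_ne_zero, if_false] at h
  simp only [kl, zero_div, add_zero]
  rw [sum_ne_zero_eq, h]; simp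

/-- A two-parameter Kloosterman sum depends only on the product of its parameters, unless both
vanish. -/
theorem sum_mul_add_div (ψ : AddChar F ℂ) {c d : F} (h : c ≠ 0 ∨ d ≠ 0) :
    ∑ x : F with x ≠ 0, ψ (c * x + d / x) = kl ψ (c * d) := by
  have key : ∀ c d : F, c ≠ 0 → ∑ x : F with x ≠ 0, ψ (c * x + d / x) = kl ψ (c * d) := by
    intro c d hc
    rw [kl, ← sum_ne_zero_mul hc fun x => ψ (x + c * d / x)]
    refine Finset.sum_congr rfl fun x hx => ?_
    rw [mul_div_mul_left _ _ hc]
  rcases h with h | h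
  · exact key c d h
  · rw [mul_comm c d, ← key d c h, ← sum_ne_zero_inv]
    refine Finset.sum_congr rfl fun x hx => ?_
    congr 1
    rw [div_inv_eq_mul, div_eq_mul_inv, add_comm]

theorem sum_phi_mul_addChar {ψ : AddChar F ℂ} (hq : Fintype.card F % 4 = 3) (y : F) :
    ∑ l, phi F l * ψ (y * l) = phi F y * gaussSum (phi F) ψ := by
  by_cases hy : y = 0
  · subst hy
    simp only [zero_mul, AddChar.map_zero_eq_one, mul_one, phi_zero]
    exact MulChar.sum_eq_zero_of_ne_one (phi_ne_one hq)
  · rw [gaussSum, ← sum_univ_mul hy fun x => phi F x * ψ x, Finset.mul_sum]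
    refine Finset.sum_congr rfl fun x _ => ?_
    rw [map_mul (phi F), ← mul_assoc, ← mul_assoc, phi_mul_self hy, one_mul]

/-- The quadratic Gaussian sum. -/
theorem sum_addChar_quadratic {ψ : AddChar F ℂ} (hψ : ψ.IsPrimitive)
    (hq : Fintype.card F % 4 = 3) {c : F} (hc : c ≠ 0) (l : F) :
    ∑ t, ψ (c * t ^ 2 + l * t) = phi F c * gaussSum (phi F) ψ * ψ (-(l ^ 2 / (4 * c))) := by
  have h2 := two_ne_zero_of_card hq
  have h4 := four_ne_zero_of_card hq
  have h1 : ∑ t, ψ (c * t ^ 2) = phi F c * gaussSum (phi F) ψ := by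
    rw [sum_sq hq (fun y => ψ (c * y))]
    simp_rw [add_mul, one_mul, Finset.sum_add_distrib]
    rw [sum_addChar_mul hψ, if_neg hc, sum_phi_mul_addChar hq, zero_add]
  rw [← h1, Finset.sum_mul]
  -- Completing the square.
  refine Fintype.sum_equiv (Equiv.addRight (l / (2 * c))) _ _ fun t => ?_
  rw [← AddChar.map_add_eq_mul]
  congr 1
  simp only [Equiv.coe_addRight]
  field_simp
  ring

end BaseField

end KatzSums

namespace KatzSums

/-! ### Norm, trace and conjugation in the quadratic extension. -/

section QuadraticExtension

variable {F K : Type*} [Field F] [Field K] [Algebra F K]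

theorem norm_zero_eq_zero [Finite K] : Algebra.norm F (0 : K) = 0 :=
  Algebra.norm_eq_zero_iff.2 rfl

theorem sum_norm_eq_mul [Fintype K] [DecidableEq F] {c : K} (hc : c ≠ 0) (n : F) (f : K → ℂ) :
    ∑ z : K with Algebra.norm F z = n, f (z * c) =
      ∑ z : K with Algebra.norm F z = n * Algebra.norm F c, f z := by
  refine Finset.sum_bij' (fun z _ => z * c) (fun z _ => z * c⁻¹) ?_ ?_ ?_ ?_ ?_
  · simp +contextual
  · intro z hz
    have hz : Algebra.norm F z = n * Algebra.norm F c := by simpa using hz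
    simp only [Finset.mem_filter, Finset.mem_univ, true_and]
    rw [map_mul, hz, mul_assoc, ← map_mul, mul_inv_cancel₀ hc, map_one, mul_one]
  · simp [hc]
  · simp [hc]
  · simp

variable [Fintype F]

/-- The nontrivial automorphism `z ↦ z ^ q` of the quadratic extension `K / F`. -/
noncomputable def conj (F : Type*) {K : Type*} [Field F] [Fintype F] [Field K] [Algebra F K] :
    K →ₐ[F] K :=
  FiniteField.frobeniusAlgHom F K

theorem conj_apply (z : K) : conj F z = z ^ Fintype.card F := rfl

variable [Fintype K]

theorem algebraMap_trace (hK : Module.finrank F K = 2) (z : K) :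
    algebraMap F K (Algebra.trace F K z) = z + conj F z := by
  rw [FiniteField.algebraMap_trace_eq_sum_pow, hK, conj_apply]
  simp [Finset.sum_range_succ]

theorem algebraMap_norm (hK : Module.finrank F K = 2) (z : K) :
    algebraMap F K (Algebra.norm F z) = z * conj F z := by
  rw [FiniteField.algebraMap_norm_eq_prod_pow, hK, conj_apply]
  simp [Finset.prod_range_succ]

theorem conj_conj (hK : Module.finrank F K = 2) (z : K) : conj F (conj F z) = z := by
  have h : conj F z = algebraMap F K (Algebra.trace F K z) - z := by
    rw [algebraMap_trace hK]; ring
  rw [h, map_sub, AlgHom.commutes, algebraMap_trace hK]; ring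

theorem norm_conj (hK : Module.finrank F K = 2) (z : K) :
    Algebra.norm F (conj F z) = Algebra.norm F z := by
  apply (algebraMap F K).injective
  rw [algebraMap_norm hK, algebraMap_norm hK, conj_conj hK, mul_comm]

theorem trace_conj (hK : Module.finrank F K = 2) (z : K) :
    Algebra.trace F K (conj F z) = Algebra.trace F K z := by
  apply (algebraMap F K).injective
  rw [algebraMap_trace hK, algebraMap_trace hK, conj_conj hK, add_comm]

theorem card_eq_sq (hK : Module.finrank F K = 2) : Fintype.card K = Fintype.card F ^ 2 := by
  rw [Module.card_eq_pow_finrank (K := F) (V := K), hK]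

theorem exists_sq_eq_neg_one (hK : Module.finrank F K = 2) (hq : Fintype.card F % 4 = 3) :
    ∃ i : K, i ^ 2 = -1 ∧ conj F i = -i := by
  have : IsSquare (-1 : K) := by
    rw [FiniteField.isSquare_neg_one_iff, card_eq_sq hK, Nat.pow_mod, hq]; norm_num
  obtain ⟨i, hi⟩ := this
  have hi2 : i ^ 2 = -1 := by rw [hi, sq]
  refine ⟨i, hi2, ?_⟩
  have h : Fintype.card F = 2 * (2 * (Fintype.card F / 4) + 1) + 1 := by omega
  rw [conj_apply, h, pow_succ, pow_mul, hi2, pow_succ, pow_mul]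
  norm_num

/-- Euler's criterion: (q² - 1)/2 = (q + 1)(q - 1)/2, so the test power of s is N(s)^((q-1)/2) = 1.
-/
theorem exists_sq_eq_of_norm_eq_one (hK : Module.finrank F K = 2)
    (hq : Fintype.card F % 4 = 3) {s : K} (hs : Algebra.norm F s = 1) : ∃ r : K, r ^ 2 = s := by
  have hs0 : s ≠ 0 := by
    rintro rfl
    simp at hs
  have hodd : Fintype.card K % 2 = 1 := by 
    rw [card_eq_sq hK, Nat.pow_mod, show Fintype.card F % 2 = 1 by omega]
  have hchar : ringChar K ≠ 2 := by
    intro h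
    have := FiniteField.even_card_of_char_two h
    omega
  obtain ⟨r, hr⟩ := (FiniteField.isSquare_iff hchar hs0).2 (by
    have hdiv : Fintype.card K / 2 = (Fintype.card F + 1) * (Fintype.card F / 2) := by
      obtain ⟨m, hm⟩ : ∃ m, Fintype.card F = 2 * m + 1 := ⟨Fintype.card F / 2, by omega⟩
      have h1 : Fintype.card F / 2 = m := by omega
      rw [card_eq_sq hK, h1, hm]
      have : (2 * m + 1) ^ 2 = 2 * ((2 * m + 1 + 1) * m) + 1 := by ring
      omega
    rw [hdiv, pow_mul, pow_succ', ← conj_apply, ← algebraMap_norm hK, hs, map_one, one_pow])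
  exact ⟨r, by rw [hr, sq]⟩

/-- In coordinates z = u + vi with i² = -1, the trace is 2u and the norm u² + v². The sign in 1 - φ,
opposite to that in `sum_add_div`, comes from φ(-1) = -1. -/
theorem sum_norm_eq [DecidableEq F] (hK : Module.finrank F K = 2) (hq : Fintype.card F % 4 = 3)
    (n : F) (f : F → ℂ) :
    ∑ z : K with Algebra.norm F z = n, f (Algebra.trace F K z) =
      ∑ y, (1 - phi F (y ^ 2 - 4 * n)) * f y := by
  have h2 := two_ne_zero_of_card hq
  obtain ⟨i, hi, hci⟩ := exists_sq_eq_neg_one hK hq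
  let e : F × F → K := fun p => algebraMap F K p.1 + algebraMap F K p.2 * i
  have hconj (p : F × F) : conj F (e p) = algebraMap F K p.1 - algebraMap F K p.2 * i := by
    simp only [e, map_add, map_mul, AlgHom.commutes, hci]; ring
  have htr (p : F × F) : Algebra.trace F K (e p) = 2 * p.1 := by
    apply (algebraMap F K).injective
    rw [algebraMap_trace hK, hconj, map_mul, map_ofNat]; simp only [e]; ring
  have hnm (p : F × F) : Algebra.norm F (e p) = p.1 ^ 2 + p.2 ^ 2 := by
    apply (algebraMap F K).injective
    rw [algebraMap_norm hK, hconj, map_add, map_pow, map_pow]; simp only [e]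
    linear_combination -(algebraMap F K p.2) ^ 2 * hi
  have hi0 : i ≠ 0 := by rintro rfl; norm_num at hi
  have hinj : Function.Injective e := by
    intro p p' h
    have h1 : p.1 = p'.1 := mul_left_cancel₀ h2 (by rw [← htr, ← htr, h])
    refine Prod.ext h1 ((algebraMap F K).injective (mul_right_cancel₀ hi0 ?_))
    simpa [e, h1] using h
  have hbij : Function.Bijective e := by
    rw [Fintype.bijective_iff_injective_and_card]
    refine ⟨hinj, ?_⟩
    rw [Fintype.card_prod, card_eq_sq hK, sq]
  have h4 : phi F 4 = 1 := by
    rw [show (4 : F) = 2 ^ 2 by norm_num, phi_sq h2]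
  calc _ = ∑ p : F × F with p.2 ^ 2 = n - p.1 ^ 2, f (2 * p.1) := by
        rw [Finset.sum_filter, Finset.sum_filter]
        symm
        refine Fintype.sum_bijective e hbij _ _ fun p => ?_
        rw [htr, hnm]
        refine if_congr ?_ rfl rfl
        rw [eq_sub_iff_add_eq, add_comm]
    _ = ∑ y, (1 + phi F (n - y ^ 2)) * f (2 * y) :=
        sum_curve hq (fun y => n - y ^ 2) fun y => f (2 * y)
    _ = _ := by
        rw [← sum_univ_mul h2 fun y => (1 - phi F (y ^ 2 - 4 * n)) * f y]
        refine Finset.sum_congr rfl fun y _ => ?_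
        rw [show (2 * y) ^ 2 - 4 * n = 4 * -(n - y ^ 2) by ring, map_mul, phi_neg hq, h4]
        ring

variable [DecidableEq F]

theorem sum_norm_eq_add_sum_add_div (hK : Module.finrank F K = 2)
    (hq : Fintype.card F % 4 = 3) {n : F} (hn : n ≠ 0) (f : F → ℂ) :
    ∑ z : K with Algebra.norm F z = n, f (Algebra.trace F K z) =
      2 * ∑ y, f y - ∑ x : F with x ≠ 0, f (x + n / x) := by
  rw [sum_norm_eq hK hq, sum_add_div hq hn, Finset.mul_sum, ← Finset.sum_sub_distrib]
  refine Finset.sum_congr rfl fun y _ => ?_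
  ring

/-- The Kloosterman sum of the quadratic extension in terms of the one of the base field. -/
theorem sum_norm_eq_addChar [DecidableEq K] (hK : Module.finrank F K = 2)
    (hq : Fintype.card F % 4 = 3)
    {ψ : AddChar F ℂ} (hψ : ψ.IsPrimitive) {n : F} (hn : n ≠ 0) (c : K) :
    ∑ z : K with Algebra.norm F z = n, ψ (Algebra.trace F K (z * c)) =
      -kl ψ (n * Algebra.norm F c) + if c = 0 then (Fintype.card F : ℂ) else 0 := by
  by_cases hc : c = 0
  · subst hc
    have h := sum_norm_eq_add_sum_add_div hK hq hn (fun _ => 1)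
    have hF : ((Finset.univ.filter fun x : F => x ≠ 0).card : ℂ) = Fintype.card F - 1 := by
      have := sum_ne_zero_eq (fun _ : F => (1 : ℂ))
      simpa using this
    simp only [mul_zero, map_zero, AddChar.map_zero_eq_one, if_true, norm_zero_eq_zero, kl_zero hψ]
    rw [h]
    simp only [Finset.sum_const, nsmul_eq_mul, mul_one, hF, Finset.card_univ]
    ring
  · have hc' : Algebra.norm F c ≠ 0 := Algebra.norm_ne_zero_iff.2 hc
    rw [if_neg hc, add_zero, sum_norm_eq_mul hc n fun z => ψ (Algebra.trace F K z),
      sum_norm_eq_add_sum_add_div hK hq (mul_ne_zero hn hc') fun y => ψ y]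
    have := sum_addChar_mul hψ 1
    simp only [one_mul, one_ne_zero, if_false] at this
    rw [this, kl]; ring

/-! ### A character of order 8 on the norm-one circle. -/

section OrderEight

variable {M : MulChar K ℂ}

/-- Both sides are the quadratic character of K: each takes the value -1 at a generator of the
cyclic group of units. -/
theorem pow_four_eq_phi_norm (hq : Fintype.card F % 4 = 3) (hM : orderOf M = 8) (y : K) :
    M y ^ 4 = phi F (Algebra.norm F y) := by
  by_cases hy : y = 0
  · subst hy
    rw [norm_zero_eq_zero, phi_zero, MulChar.map_zero, zero_pow four_ne_zero]
  obtain ⟨g, hg⟩ := IsCyclic.exists_generator (α := Kˣ)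
  have hMg8 : M g ^ 8 = 1 := by
    rw [← MulChar.pow_apply_coe, ← hM, pow_orderOf_eq_one, MulChar.one_apply_coe]
  have key (χ : Kˣ →* ℂ) (h : ∃ u, χ u ≠ 1) : χ g ≠ 1 := by
    rintro h1
    obtain ⟨u, hu⟩ := h
    obtain ⟨m, rfl⟩ := (Submonoid.mem_powers_iff u g).1
      ((mem_powers_iff_mem_zpowers).2 (hg u))
    exact hu (by rw [map_pow, h1, one_pow])
  have hMg : M g ^ 4 = -1 := by
    have h1 : M g ^ 4 * M g ^ 4 = 1 := by rw [← pow_add]; exact hMg8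
    refine (mul_self_eq_one_iff.1 h1).resolve_left ?_
    rw [← MulChar.pow_apply_coe]
    refine key ((M ^ 4 : MulChar K ℂ).toMonoidHom.comp (Units.coeHom K)) ?_
    by_contra! hall
    have : M ^ 4 = 1 := by
      ext u
      rw [MulChar.one_apply_coe]
      exact hall u
    have := orderOf_dvd_of_pow_eq_one this
    rw [hM] at this
    norm_num at this
  have hNg : phi F (Algebra.norm F (g : K)) = -1 := by
    refine (phi_eq_one_or (Algebra.norm_ne_zero_iff.2 g.ne_zero)).resolve_left ?_
    refine key (((phi F).toMonoidHom.comp (Algebra.norm F)).comp (Units.coeHom K)) ?_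
    obtain ⟨y, hy⟩ := FiniteField.norm_surjective F K (-1)
    have hy0 : y ≠ 0 := by
      rintro rfl
      rw [Algebra.norm_eq_zero_iff.2 rfl] at hy
      norm_num at hy
    refine ⟨Units.mk0 y hy0, ?_⟩
    change phi F (Algebra.norm F y) ≠ 1
    rw [hy, phi_neg_one hq]
    norm_num
  obtain ⟨m, hm⟩ := (Submonoid.mem_powers_iff (Units.mk0 y hy) g).1
      ((mem_powers_iff_mem_zpowers).2 (hg _))
  have hm' : y = (g : K) ^ m := by rw [← Units.val_pow_eq_pow_val, hm]; rfl
  rw [hm', map_pow, map_pow, map_pow, hNg, ← hMg]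
  ring

theorem pow_eight_eq_one (hq : Fintype.card F % 4 = 3) (hM : orderOf M = 8) {y : K} (hy : y ≠ 0) :
    M y ^ 8 = 1 := by
  rw [show 8 = 4 + 4 from rfl, pow_add, pow_four_eq_phi_norm (F := F) hq hM,
    phi_mul_self (Algebra.norm_ne_zero_iff.2 hy)]

/-- Every w is a norm y^(q+1), and 8 divides 2(q + 1). -/
theorem sq_apply_algebraMap (hK : Module.finrank F K = 2) (hq : Fintype.card F % 4 = 3)
    (hM : orderOf M = 8) {w : F} (hw : w ≠ 0) : M (algebraMap F K w) ^ 2 = 1 := by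
  obtain ⟨y, rfl⟩ := FiniteField.norm_surjective F K w
  have hy : y ≠ 0 := Algebra.norm_ne_zero_iff.1 hw
  have h : (Fintype.card F + 1) * 2 = 8 * ((Fintype.card F + 1) / 4) := by omega
  rw [algebraMap_norm hK, conj_apply, ← pow_succ', map_pow, ← pow_mul, h, pow_mul,
    pow_eight_eq_one hq hM hy, one_pow]

/-- For N(s) = 1, both s(Tr s + 2) = (1 + s)² and N(1 + s) = Tr s + 2. Squaring M in the first
identity removes the factor from F and leaves M(1 + s)⁴ = φ(N(1 + s)). -/
theorem sq_apply_of_norm_eq_one (hK : Module.finrank F K = 2) (hq : Fintype.card F % 4 = 3)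
    (hM : orderOf M = 8) {s : K} (hs : Algebra.norm F s = 1) (hs1 : s ≠ -1) :
    M s ^ 2 = phi F (Algebra.trace F K s + 2) := by
  have h1 : 1 + s ≠ 0 := fun h => hs1 (by linear_combination h)
  have hs' : s * conj F s = 1 := by rw [← algebraMap_norm hK, hs, map_one]
  have hw : Algebra.norm F (1 + s) = Algebra.trace F K s + 2 := by
    apply (algebraMap F K).injective
    rw [algebraMap_norm hK, map_add, map_add, algebraMap_trace hK, map_ofNat, map_one]
    linear_combination hs'
  have hw0 : Algebra.trace F K s + 2 ≠ 0 := by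
    rw [← hw]; exact Algebra.norm_ne_zero_iff.2 h1
  have h2 : s * algebraMap F K (Algebra.trace F K s + 2) = (1 + s) ^ 2 := by
    rw [map_add, algebraMap_trace hK, map_ofNat]
    linear_combination hs'
  have h3 : M s ^ 2 * M (algebraMap F K (Algebra.trace F K s + 2)) ^ 2 = M (1 + s) ^ 4 := by
    rw [← mul_pow, ← map_mul, h2, map_pow]; ring
  rw [sq_apply_algebraMap hK hq hM hw0, mul_one, pow_four_eq_phi_norm (F := F) hq hM, hw] at h3
  exact h3

/-- Apply the previous formula to s = i, which has norm 1 and trace 0. -/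
theorem apply_neg_one (hK : Module.finrank F K = 2) (hq : Fintype.card F % 4 = 3)
    (hM : orderOf M = 8) : M (-1) = phi F 2 := by
  obtain ⟨i, hi, hci⟩ := exists_sq_eq_neg_one (F := F) (K := K) hK hq
  have hn : Algebra.norm F i = 1 := by
    apply (algebraMap F K).injective
    rw [algebraMap_norm hK, hci, map_one]; linear_combination -hi
  have ht : Algebra.trace F K i = 0 := by
    apply (algebraMap F K).injective
    rw [algebraMap_trace hK, hci, map_zero]; ring
  have h2 : (2 : K) ≠ 0 := by
    rw [← map_ofNat (algebraMap F K) 2]; exact (map_ne_zero _).2 (two_ne_zero_of_card hq)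
  have hi1 : i ≠ -1 := by
    rintro rfl
    exact h2 (by linear_combination hi)
  have := sq_apply_of_norm_eq_one hK hq hM hn hi1
  rw [← map_pow, hi, ht, zero_add] at this
  exact this

/-- Summing over squares of norm-one elements kills the nonsquares. -/
theorem sum_norm_one_sq (hK : Module.finrank F K = 2) (hq : Fintype.card F % 4 = 3)
    (hM : orderOf M = 8) (f : F → ℂ) :
    ∑ r : K with Algebra.norm F r = 1, M (r ^ 2) * f (Algebra.trace F K (r ^ 2)) =
      2 * ∑ s : K with Algebra.norm F s = 1, M s * f (Algebra.trace F K s) := by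
  classical
  -- The roots ±r₀ of s share a norm, which is 1 or -1; M(s)² = φ(N r₀) detects which.
  have hroot (s : K) (hs : Algebra.norm F s = 1) :
      ∑ r : K with Algebra.norm F r = 1, (if r ^ 2 = s then (1 : ℂ) else 0) = 1 + M s ^ 2 := by
    obtain ⟨r₀, hr₀⟩ := exists_sq_eq_of_norm_eq_one hK hq hs
    have hr₀0 : r₀ ≠ 0 := by
      rintro rfl
      rw [← hr₀] at hs
      simp at hs
    have h2 : (2 : K) ≠ 0 := by
      rw [← map_ofNat (algebraMap F K) 2]; exact (map_ne_zero _).2 (two_ne_zero_of_card hq)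
    have hne : r₀ ≠ -r₀ := fun h =>
      mul_ne_zero h2 hr₀0 (by linear_combination h)
    have hMs : M s ^ 2 = phi F (Algebra.norm F r₀) := by
      rw [← pow_four_eq_phi_norm hq hM, ← hr₀, map_pow]; ring
    have hneg : Algebra.norm F (-r₀) = Algebra.norm F r₀ := by
      apply (algebraMap F K).injective
      rw [algebraMap_norm hK, algebraMap_norm hK, map_neg]; ring
    have hsq : Algebra.norm F r₀ * Algebra.norm F r₀ = 1 := by
      rw [← map_mul, ← sq, hr₀, hs]
    rw [Finset.sum_boole, Finset.filter_filter, hMs]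
    rcases mul_self_eq_one_iff.1 hsq with h | h
    · have : (Finset.univ.filter fun r : K => Algebra.norm F r = 1 ∧ r ^ 2 = s) = {r₀, -r₀} := by
        ext r
        simp only [Finset.mem_filter, Finset.mem_univ, true_and, Finset.mem_insert,
          Finset.mem_singleton]
        rw [← hr₀, sq_eq_sq_iff_eq_or_eq_neg]
        refine ⟨fun h => h.2, ?_⟩
        rintro (rfl | rfl) <;> simp [hneg, h]
      rw [this, Finset.card_pair hne, h, map_one]; norm_num
    · have : (Finset.univ.filter fun r : K => Algebra.norm F r = 1 ∧ r ^ 2 = s) = ∅ := by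
        ext r
        simp only [Finset.mem_filter, Finset.mem_univ, true_and, Finset.notMem_empty, iff_false]
        rintro ⟨h1, h3⟩
        have h4 : Algebra.norm F r = -1 := by
          rw [← hr₀, sq_eq_sq_iff_eq_or_eq_neg] at h3
          rcases h3 with rfl | rfl
          · exact h
          · rw [hneg, h]
        rw [h1] at h4
        exact two_ne_zero_of_card hq (by linear_combination h4)
      rw [this, h, phi_neg_one hq]; norm_num
  -- On the norm-one circle conjugation is inversion and M⁴ = 1, so M(s)³ = M(s̄).
  have hconj : ∑ s : K with Algebra.norm F s = 1, M s ^ 3 * f (Algebra.trace F K s) =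
      ∑ s : K with Algebra.norm F s = 1, M s * f (Algebra.trace F K s) := by
    refine Finset.sum_bij' (fun s _ => conj F s) (fun s _ => conj F s) ?_ ?_ ?_ ?_ ?_
    · intro s hs; simpa [norm_conj hK] using hs
    · intro s hs; simpa [norm_conj hK] using hs
    · intro s hs; exact conj_conj hK s
    · intro s hs; exact conj_conj hK s
    · intro s hs
      have hs : Algebra.norm F s = 1 := by simpa using hs
      rw [trace_conj hK]
      have h4 := pow_four_eq_phi_norm (F := F) hq hM s
      rw [hs, map_one] at h4
      have h1 : M s * M (conj F s) = 1 := by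
        rw [← map_mul, ← algebraMap_norm hK, hs, map_one, map_one]
      congr 1
      linear_combination M (conj F s) * h4 - M s ^ 3 * h1
  calc _ = ∑ r : K with Algebra.norm F r = 1, ∑ s : K with Algebra.norm F s = 1,
        (if r ^ 2 = s then (1 : ℂ) else 0) * (M s * f (Algebra.trace F K s)) := by
        refine Finset.sum_congr rfl fun r hr => ?_
        have hr : Algebra.norm F r = 1 := by simpa using hr
        simp only [ite_mul, one_mul, zero_mul]
        rw [Finset.sum_ite_eq, if_pos (by simp [hr])]
    _ = ∑ s : K with Algebra.norm F s = 1, (1 + M s ^ 2) * (M s * f (Algebra.trace F K s)) := by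
        rw [Finset.sum_comm]
        refine Finset.sum_congr rfl fun s hs => ?_
        rw [← Finset.sum_mul, hroot s (by simpa using hs)]
    _ = ∑ s : K with Algebra.norm F s = 1, M s * f (Algebra.trace F K s) +
        ∑ s : K with Algebra.norm F s = 1, M s ^ 3 * f (Algebra.trace F K s) := by
        rw [← Finset.sum_add_distrib]
        refine Finset.sum_congr rfl fun s _ => ?_
        ring
    _ = _ := by rw [hconj]; ring

/-- Substitute s = r² and count the r of given trace y. The weight (1 - φ(y² - 4))φ(y + 2) becomes
φ(y + 2) - φ(y - 2) away from y = -2, and y ↦ -y makes the two halves equal, cancelling the 2 of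
`sum_norm_one_sq`. -/
theorem sum_norm_one_apply (hK : Module.finrank F K = 2) (hq : Fintype.card F % 4 = 3)
    (hM : orderOf M = 8) (f : F → ℂ) :
    ∑ s : K with Algebra.norm F s = 1, M s * f (Algebra.trace F K s + 2) =
      phi F 2 * ∑ t, phi F (t + 1) * f (4 * t ^ 2) := by
  classical
  have h2 := two_ne_zero_of_card hq
  have h4 : phi F 4 = 1 := by
    rw [show (4 : F) = 2 ^ 2 by norm_num, phi_sq h2]
  -- At r = -1 the quadratic character vanishes while M(r²) = 1; the resulting f(4) cancels against
  -- the one in `hy`.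
  have hterm (r : K) (hr : Algebra.norm F r = 1) :
      M (r ^ 2) * f (Algebra.trace F K (r ^ 2) + 2) =
        phi F (Algebra.trace F K r + 2) * f (Algebra.trace F K r ^ 2) +
          if r = -1 then f 4 else 0 := by
    have htr : Algebra.trace F K (r ^ 2) + 2 = Algebra.trace F K r ^ 2 := by
      apply (algebraMap F K).injective
      have hr' : r * conj F r = 1 := by rw [← algebraMap_norm hK, hr, map_one]
      rw [map_add, map_pow (algebraMap F K), algebraMap_trace hK, algebraMap_trace hK, map_ofNat,
        map_pow (conj F)]
      linear_combination -2 * hr'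
    rw [htr]
    by_cases h : r = -1
    · have : Algebra.trace F K r = -2 := by
        apply (algebraMap F K).injective
        rw [algebraMap_trace hK, h, map_neg, map_neg, map_ofNat, map_one]; norm_num
      rw [if_pos h, this, h]
      norm_num [phi_zero]
    · rw [if_neg h, add_zero, map_pow, sq_apply_of_norm_eq_one hK hq hM hr h]
  have hnorm : Algebra.norm F (-1 : K) = 1 := by
    apply (algebraMap F K).injective
    rw [algebraMap_norm hK, map_neg, map_one, map_one]; norm_num
  have hy (y : F) : (1 - phi F (y ^ 2 - 4 * 1)) * (phi F (y + 2) * f (y ^ 2)) =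
      phi F (y + 2) * f (y ^ 2) - phi F (y - 2) * f (y ^ 2) - if y = -2 then f 4 else 0 := by
    rw [show y ^ 2 - 4 * 1 = (y - 2) * (y + 2) by ring, map_mul]
    by_cases h : y = -2
    · subst h
      rw [if_pos rfl, show (-2 : F) - 2 = -4 by norm_num, show (-2 : F) + 2 = 0 by norm_num,
        show (-2 : F) ^ 2 = 4 by norm_num, phi_neg hq, phi_zero, h4]
      ring
    · have h' : y + 2 ≠ 0 := fun h' => h (by linear_combination h')
      rw [if_neg h]
      linear_combination -phi F (y - 2) * f (y ^ 2) * phi_mul_self h'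
  have hneg : ∑ y : F, phi F (y - 2) * f (y ^ 2) = -∑ y : F, phi F (y + 2) * f (y ^ 2) := by
    rw [← Finset.sum_neg_distrib]
    refine Fintype.sum_equiv (Equiv.neg F) _ _ fun y => ?_
    rw [Equiv.neg_apply, neg_sq, show -y + 2 = -(y - 2) by ring, phi_neg hq]
    ring
  have h := sum_norm_one_sq hK hq hM fun y => f (y + 2)
  rw [Finset.sum_congr rfl fun r hr => hterm r (by simpa using hr), Finset.sum_add_distrib,
    Finset.sum_ite_eq', if_pos (by simp [hnorm]),
    sum_norm_eq hK hq 1 fun y => phi F (y + 2) * f (y ^ 2), Finset.sum_congr rfl fun y _ => hy y,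
    Finset.sum_sub_distrib, Finset.sum_sub_distrib, hneg, Finset.sum_ite_eq',
    if_pos (Finset.mem_univ _)] at h
  have hs : ∑ y : F, phi F (y + 2) * f (y ^ 2) =
      phi F 2 * ∑ t, phi F (t + 1) * f (4 * t ^ 2) := by
    rw [← sum_univ_mul h2 fun y => phi F (y + 2) * f (y ^ 2), Finset.mul_sum]
    refine Finset.sum_congr rfl fun t _ => ?_
    rw [show 2 * t + 2 = 2 * (t + 1) by ring, map_mul, mul_pow, show (2 : F) ^ 2 = 4 by norm_num]
    ring
  rw [← hs]
  linear_combination -h / 2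

end OrderEight

end QuadraticExtension

end KatzSums

namespace KatzSums

/-! ### The canonical additive characters. -/

section Psi

variable (p : ℕ) [Fact p.Prime] {F K : Type*} [Field F] [Finite F] [Algebra (ZMod p) F]
  [Field K] [Finite K] [Algebra (ZMod p) K] [Algebra F K]

theorem psi_apply {F : Type*} [Field F] [Algebra (ZMod p) F] (x : F) :
    psi p F x = ZMod.stdAddChar (Algebra.trace (ZMod p) F x) := rfl

theorem psi_isPrimitive : (psi p F).IsPrimitive := by
  refine AddChar.IsPrimitive.of_ne_one (AddChar.ne_one_iff.2 ?_)
  obtain ⟨x, hx⟩ := Algebra.trace_surjective (ZMod p) F 1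
  refine ⟨x, fun h => ?_⟩
  rw [psi_apply, hx, ← AddChar.map_zero_eq_one (ZMod.stdAddChar (N := p))] at h
  exact one_ne_zero (ZMod.injective_stdAddChar h)

theorem psi_eq_psi_trace (z : K) : psi p K z = psi p F (Algebra.trace F K z) := by
  have : IsScalarTower (ZMod p) F K := IsScalarTower.of_algebraMap_eq' (Subsingleton.elim _ _)
  rw [psi_apply, psi_apply, Algebra.trace_trace]

end Psi

/-! ### The mixed sum as an average of Kloosterman sums. -/

section BaseField

variable {F : Type*} [Field F] [Fintype F] [DecidableEq F]

/-- The involution x ↦ a/x fixes the phase and reverses the sign of φ(a/x - x). -/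
theorem sum_phi_sub_mul_addChar_eq_zero (hq : Fintype.card F % 4 = 3) (ψ : AddChar F ℂ) {a : F}
    (ha : a ≠ 0) (c : F) :
    ∑ x : F with x ≠ 0, phi F (a / x - x) * ψ (x * c + (a / x) * c) = 0 := by
  have h : ∑ x : F with x ≠ 0, phi F (a / x - x) * ψ (x * c + (a / x) * c) =
      ∑ x : F with x ≠ 0, -(phi F (a / x - x) * ψ (x * c + (a / x) * c)) := by
    have hinv (x : F) : a / (a / x) = x := by field_simp
    refine Finset.sum_bij' (fun x _ => a / x) (fun x _ => a / x) ?_ ?_ ?_ ?_ ?_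
    · intro x hx; simpa [ha] using hx
    · intro x hx; simpa [ha] using hx
    · intro x _; exact hinv x
    · intro x _; exact hinv x
    · intro x _
      rw [hinv, ← neg_mul, ← phi_neg hq, neg_sub, add_comm (x * c)]
  rw [Finset.sum_neg_distrib] at h
  linear_combination h / 2

/-- The mixed sum as a quadratic twist of Kloosterman sums. -/
theorem gaussSum_mul_sum_phi_sub (hq : Fintype.card F % 4 = 3) (ψ : AddChar F ℂ) {a A B : F}
    (ha : a ≠ 0) (hAB : A + B ≠ 0) :
    gaussSum (phi F) ψ * ∑ x : F with x ≠ 0, phi F (a / x - x) * ψ (x * B + (a / x) * A) =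
      ∑ m, phi F m * kl ψ (a * ((B - m) * (A + m))) := by
  calc _ = ∑ x : F with x ≠ 0, ∑ m, phi F m * ψ ((B - m) * x + a * (A + m) / x) := by
        rw [Finset.mul_sum]
        refine Finset.sum_congr rfl fun x _ => ?_
        rw [← mul_assoc, mul_comm (gaussSum _ _), ← sum_phi_mul_addChar hq, Finset.sum_mul]
        refine Finset.sum_congr rfl fun m _ => ?_
        rw [mul_assoc, ← AddChar.map_add_eq_mul]
        congr 2
        ring
    _ = _ := by
        rw [Finset.sum_comm]
        refine Finset.sum_congr rfl fun m _ => ?_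
        have h : B - m ≠ 0 ∨ a * (A + m) ≠ 0 := by
          by_contra! h
          have h2 := (mul_eq_zero.1 h.2).resolve_left ha
          exact hAB (by linear_combination h.1 + h2)
        rw [← Finset.mul_sum, sum_mul_add_div ψ h]
        congr 2
        ring

/-- Gaussian summation inside a quadratic twist of Kloosterman sums. -/
theorem sum_phi_add_mul_kl (hq : Fintype.card F % 4 = 3) {ψ : AddChar F ℂ} (hψ : ψ.IsPrimitive)
    {a A B d : F} (ha : a ≠ 0) (hd : B - A = 4 * d) :
    ∑ t, phi F (t + 2 * d) * kl ψ (a * (A * B + t ^ 2)) =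
      phi F 2 * ∑ m, phi F m * kl ψ (a * ((B - m) * (A + m))) := by
  have h2 := two_ne_zero_of_card hq
  have h4 := four_ne_zero_of_card hq
  -- The factor G opens φ(t + 2d) into additive characters, leaving a quadratic Gaussian sum in t.
  apply mul_left_cancel₀ (gaussSum_phi_ne_zero hq hψ)
  calc _ = ∑ t, ∑ x : F with x ≠ 0, ∑ l, phi F l * ψ ((t + 2 * d) * l) *
          ψ (x + a * (A * B + t ^ 2) / x) := by
        rw [Finset.mul_sum]
        refine Finset.sum_congr rfl fun t _ => ?_
        rw [← mul_assoc, mul_comm (gaussSum _ _), ← sum_phi_mul_addChar hq, kl, Finset.mul_sum]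
        refine Finset.sum_congr rfl fun x _ => ?_
        rw [Finset.sum_mul]
    _ = ∑ x : F with x ≠ 0, ∑ l, ∑ t, phi F l * ψ ((t + 2 * d) * l) *
          ψ (x + a * (A * B + t ^ 2) / x) := by
        rw [Finset.sum_comm]
        refine Finset.sum_congr rfl fun x _ => Finset.sum_comm
    _ = ∑ x : F with x ≠ 0, ∑ m, gaussSum (phi F) ψ * (phi F 2 * (phi F m *
          ψ (x + a * ((B - m) * (A + m)) / x))) := by
        refine Finset.sum_congr rfl fun x hx => ?_
        have hx : x ≠ 0 := by simpa using hx
        have hax : a / x ≠ 0 := div_ne_zero ha hx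
        -- With l = 2(a/x)m, completing the square in t leaves the phase -(a/x)m².
        rw [← sum_univ_mul (mul_ne_zero h2 hax)]
        refine Finset.sum_congr rfl fun m _ => ?_
        have h1 (t : F) : ψ ((t + 2 * d) * (2 * (a / x) * m)) *
            ψ (x + a * (A * B + t ^ 2) / x) =
            ψ (2 * d * (2 * (a / x) * m) + x + a * (A * B) / x) *
              ψ (a / x * t ^ 2 + 2 * (a / x) * m * t) := by
          rw [← AddChar.map_add_eq_mul, ← AddChar.map_add_eq_mul]
          congr 1
          ring
        simp_rw [mul_assoc (phi F _), h1]
        rw [← Finset.mul_sum, ← Finset.mul_sum, sum_addChar_quadratic hψ hq hax, map_mul, map_mul]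
        have h3 : ψ (2 * d * (2 * (a / x) * m) + x + a * (A * B) / x) *
            ψ (-((2 * (a / x) * m) ^ 2 / (4 * (a / x)))) =
            ψ (x + a * ((B - m) * (A + m)) / x) := by
          rw [← AddChar.map_add_eq_mul]
          congr 1
          field_simp
          linear_combination -4 * a * m * hd
        rw [← h3]
        linear_combination phi F 2 * phi F m * gaussSum (phi F) ψ *
          ψ (2 * d * (2 * (a / x) * m) + x + a * (A * B) / x) *
            ψ (-((2 * (a / x) * m) ^ 2 / (4 * (a / x)))) * phi_mul_self hax
    _ = _ := by
        rw [Finset.sum_comm, Finset.mul_sum, Finset.mul_sum]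
        refine Finset.sum_congr rfl fun m _ => ?_
        rw [← Finset.mul_sum, ← Finset.mul_sum, ← Finset.mul_sum, kl]

end BaseField

/-! ### The product of two norm-restricted sums. -/

section Product

variable {F K : Type*} [Field F] [Fintype F] [Field K] [Fintype K] [Algebra F K]

theorem norm_sq_add_sq_mul_conj (hK : Module.finrank F K = 2) (j k : F) {s : K}
    (hs : Algebra.norm F s = 1) :
    Algebra.norm F (algebraMap F K j ^ 2 + algebraMap F K k ^ 2 * conj F s) =
      (j ^ 2 - k ^ 2) ^ 2 + j ^ 2 * k ^ 2 * (Algebra.trace F K s + 2) := by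
  have hs' : s * conj F s = 1 := by rw [← algebraMap_norm hK, hs, map_one]
  apply (algebraMap F K).injective
  simp only [algebraMap_norm hK, map_add, map_mul, map_pow, map_sub, AlgHom.commutes,
    conj_conj hK, algebraMap_trace hK, map_ofNat]
  linear_combination algebraMap F K k ^ 4 * hs'

variable [DecidableEq F] {M : MulChar K ℂ}

/-- Vanishing forces s = -k²/j², which lies in F, so s² = N(s) = 1; s = 1 would make -1 a square. -/
theorem sq_add_sq_mul_conj_eq_zero_iff (hK : Module.finrank F K = 2)
    (hq : Fintype.card F % 4 = 3) {j k : F} (hj : j ≠ 0) (hk : k ≠ 0) {s : K}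
    (hs : Algebra.norm F s = 1) :
    algebraMap F K j ^ 2 + algebraMap F K k ^ 2 * conj F s = 0 ↔ j ^ 2 = k ^ 2 ∧ s = -1 := by
  constructor
  · intro h
    have hs' : s * conj F s = 1 := by rw [← algebraMap_norm hK, hs, map_one]
    have h1 : algebraMap F K (j ^ 2) * s = -algebraMap F K (k ^ 2) := by
      rw [map_pow, map_pow]
      linear_combination s * h - algebraMap F K k ^ 2 * hs'
    have h2 : s = algebraMap F K (-k ^ 2 / j ^ 2) := by
      rw [map_div₀, map_neg, eq_div_iff (by simpa using hj), mul_comm, h1]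
    have h3 : conj F s = s := by rw [h2, AlgHom.commutes]
    have h4 : (-k ^ 2 / j ^ 2) * (-k ^ 2 / j ^ 2) = 1 := by
      apply (algebraMap F K).injective
      rw [map_mul, ← h2, map_one]
      rw [h3] at hs'
      exact hs'
    rcases mul_self_eq_one_iff.1 h4 with h5 | h5
    · exfalso
      have h6 : -(k / j) ^ 2 = 1 := by rw [← h5, div_pow]; ring
      have h7 := phi_sq (div_ne_zero hk hj)
      have h8 := phi_neg hq ((k / j) ^ 2)
      rw [h6, h7, map_one] at h8
      norm_num at h8
    · refine ⟨?_, by rw [h2, h5, map_neg, map_one]⟩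
      rw [div_eq_iff (pow_ne_zero 2 hj)] at h5
      linear_combination h5
  · rintro ⟨h, rfl⟩
    rw [← map_pow, ← map_pow, h, map_neg, map_one]
    ring

/-- The product of two norm-restricted Gauss sums as an average of Kloosterman sums. -/
theorem sum_norm_mul_sum_norm (hK : Module.finrank F K = 2) (hq : Fintype.card F % 4 = 3)
    {ψ : AddChar F ℂ} (hψ : ψ.IsPrimitive) {a j k : F} (ha : a ≠ 0) (hj : j ≠ 0) (hk : k ≠ 0) :
    (∑ z : K with Algebra.norm F z = a,
        M z * ψ (Algebra.trace F K (algebraMap F K j ^ 2 * z))) *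
      (∑ z : K with Algebra.norm F z = a,
        M z * ψ (Algebra.trace F K (algebraMap F K k ^ 2 * z))) =
    M (algebraMap F K a) * ((if j ^ 2 = k ^ 2 then Fintype.card F * M (-1) else 0) -
      ∑ s : K with Algebra.norm F s = 1,
        M s * kl ψ (a * ((j ^ 2 - k ^ 2) ^ 2 + j ^ 2 * k ^ 2 * (Algebra.trace F K s + 2)))) := by
  classical
  have hw (z : K) (hz : Algebra.norm F z = a) :
      ∑ w : K with Algebra.norm F w = a, M w * ψ (Algebra.trace F K (algebraMap F K k ^ 2 * w)) =
      ∑ s : K with Algebra.norm F s = 1, M (s * conj F z) *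
        ψ (Algebra.trace F K (algebraMap F K k ^ 2 * (s * conj F z))) := by
    have hz0 : conj F z ≠ 0 := by
      rw [← Algebra.norm_ne_zero_iff (R := F), norm_conj hK, hz]; exact ha
    rw [sum_norm_eq_mul hz0 1 fun w =>
      M w * ψ (Algebra.trace F K (algebraMap F K k ^ 2 * w)), norm_conj hK, hz, one_mul]
  calc _ = ∑ z : K with Algebra.norm F z = a, ∑ s : K with Algebra.norm F s = 1,
        M (algebraMap F K a) * (M s * ψ (Algebra.trace F K
          (z * (algebraMap F K j ^ 2 + algebraMap F K k ^ 2 * conj F s)))) := by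
        rw [Finset.sum_mul]
        refine Finset.sum_congr rfl fun z hz => ?_
        have hz : Algebra.norm F z = a := by simpa using hz
        rw [hw z hz, Finset.mul_sum]
        refine Finset.sum_congr rfl fun s _ => ?_
        -- The trace is invariant under conjugation, which moves the bar from z to s.
        have h1 : Algebra.trace F K (algebraMap F K k ^ 2 * (s * conj F z)) =
            Algebra.trace F K (algebraMap F K k ^ 2 * (conj F s * z)) := by
          rw [← trace_conj hK (algebraMap F K k ^ 2 * (conj F s * z))]
          simp only [map_mul, map_pow, AlgHom.commutes, conj_conj hK]
        have h2 : M (algebraMap F K a) = M z * M (conj F z) := by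
          rw [← map_mul, ← algebraMap_norm hK, hz]
        have h3 : z * (algebraMap F K j ^ 2 + algebraMap F K k ^ 2 * conj F s) =
            algebraMap F K j ^ 2 * z + algebraMap F K k ^ 2 * (conj F s * z) := by ring
        rw [h1, h2, h3, map_add, AddChar.map_add_eq_mul, map_mul M]
        ring
    _ = ∑ s : K with Algebra.norm F s = 1, M (algebraMap F K a) * (M s *
          (-kl ψ (a * ((j ^ 2 - k ^ 2) ^ 2 + j ^ 2 * k ^ 2 * (Algebra.trace F K s + 2))) +
            if j ^ 2 = k ^ 2 ∧ s = -1 then (Fintype.card F : ℂ) else 0)) := by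
        rw [Finset.sum_comm]
        refine Finset.sum_congr rfl fun s hs => ?_
        have hs : Algebra.norm F s = 1 := by simpa using hs
        rw [← Finset.mul_sum, ← Finset.mul_sum, sum_norm_eq_addChar hK hq hψ ha,
          norm_sq_add_sq_mul_conj hK j k hs,
          if_congr (sq_add_sq_mul_conj_eq_zero_iff hK hq hj hk hs) rfl rfl]
    _ = _ := by
        have hnorm : Algebra.norm F (-1 : K) = 1 := by
          apply (algebraMap F K).injective
          rw [algebraMap_norm hK, map_neg, map_one, map_one]; norm_num
        have h : ∑ s : K with Algebra.norm F s = 1,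
            M s * (if j ^ 2 = k ^ 2 ∧ s = -1 then (Fintype.card F : ℂ) else 0) =
            if j ^ 2 = k ^ 2 then Fintype.card F * M (-1) else 0 := by
          split_ifs with hjk
          · simp only [hjk, true_and, mul_ite, mul_zero]
            rw [Finset.sum_ite_eq', if_pos (by simp [hnorm]), mul_comm]
          · simp [hjk]
        rw [← h, ← Finset.mul_sum, ← Finset.sum_sub_distrib]
        congr 1
        refine Finset.sum_congr rfl fun s _ => ?_
        ring

end Product

/-! ### Degenerate arguments and the final comparison. -/

theorem V_eq_zero_of_eq_zero (p : ℕ) [Fact p.Prime] {F K : Type*} [Field F] [Fintype F]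
    [DecidableEq F] [Field K] [Fintype K] [Algebra F K] [Algebra (ZMod p) K]
    (M : MulChar K ℂ) (τ : ℂ) (a : F) : V p M τ a 0 = 0 := by
  rw [V, phi_zero, mul_zero, zero_mul]

theorem P_eq_zero_of_mul_eq_zero (p : ℕ) [Fact p.Prime] {F : Type*} [Field F] [Fintype F]
    [DecidableEq F] [Algebra (ZMod p) F] (hq : Fintype.card F % 4 = 3) {a j k : F} (ha : a ≠ 0)
    (h : j = 0 ∨ k = 0) : P p a j k = 0 := by
  have hsq : (j - k) ^ 2 = (j + k) ^ 2 := by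
    rcases h with rfl | rfl <;> ring
  have hδ : (j = k) ↔ (j = -k) := by
    rcases h with rfl | rfl <;> simp [eq_comm]
  rw [P, hsq, sum_phi_sub_mul_addChar_eq_zero hq _ ha, phi_neg_one hq, if_congr hδ rfl rfl]
  ring

/-- The mixed exponential sum factors as a product of norm-restricted Gauss sums. -/
theorem P_eq_V_mul_V (p : ℕ) [Fact p.Prime]
    {F K : Type*} [Field F] [Fintype F] [DecidableEq F] [Algebra (ZMod p) F]
    [Field K] [Fintype K] [Algebra (ZMod p) K]
    [Algebra F K] (hK : Module.finrank F K = 2)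
    (hq : Fintype.card F % 4 = 3)
    (M₈ : MulChar K ℂ) (hM₈ : orderOf M₈ = 8)
    (a : F) (ha : a ≠ 0)
    (τ : ℂ) (hτ : τ ^ 2 = (Fintype.card F : ℂ) * M₈ (algebraMap F K (-a)))
    (j k : F) :
    P p a j k = V p M₈ τ a j * V p M₈ τ a k := by
  by_cases hj : j = 0
  · rw [P_eq_zero_of_mul_eq_zero p hq ha (Or.inl hj), hj, V_eq_zero_of_eq_zero, zero_mul]
  by_cases hk : k = 0
  · rw [P_eq_zero_of_mul_eq_zero p hq ha (Or.inr hk), hk, V_eq_zero_of_eq_zero, mul_zero]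
  have h2 := two_ne_zero_of_card hq
  have hψ := psi_isPrimitive p (F := F)
  have hcard : (Fintype.card F : ℂ) ≠ 0 := by exact_mod_cast Fintype.card_ne_zero
  have hjk0 : j * k ≠ 0 := mul_ne_zero hj hk
  have hG := gaussSum_phi_sq hq hψ
  have hG0 := gaussSum_phi_ne_zero hq hψ
  have hMa : M₈ (algebraMap F K a) * M₈ (algebraMap F K a) = 1 := by
    rw [← sq, sq_apply_algebraMap hK hq hM₈ ha]
  have hτ' : τ ^ 2 = Fintype.card F * (phi F 2 * M₈ (algebraMap F K a)) := by
    rw [hτ, map_neg, neg_eq_neg_one_mul, map_mul, apply_neg_one hK hq hM₈]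
  have hτ0 : τ ≠ 0 := by
    rintro rfl
    have h3 := phi_mul_self h2
    have h4 : phi F 2 * M₈ (algebraMap F K a) = 0 := by
      refine (mul_eq_zero.1 ?_).resolve_left hcard
      rw [← hτ']; norm_num
    rcases mul_eq_zero.1 h4 with h | h
    · rw [h] at h3; norm_num at h3
    · rw [h] at hMa; norm_num at hMa
  -- The sum is 2(j² + k²), nonzero because -1 is not a square.
  have hAB : (j - k) ^ 2 + (j + k) ^ 2 ≠ 0 := by
    intro h
    have h3 : j ^ 2 = -k ^ 2 := by
      have : 2 * (j ^ 2 + k ^ 2) = 0 := by linear_combination h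
      linear_combination (mul_eq_zero.1 this).resolve_left h2
    have h4 := phi_neg hq (k ^ 2)
    rw [← h3, phi_sq hj, phi_sq hk] at h4
    norm_num at h4
  -- Here B - A = 4jk and AB = (j² - k²)²; rescaling t by 2jk aligns the two averages.
  have hsum : phi F (j * k) * ∑ s : K with Algebra.norm F s = 1, M₈ s * kl (psi p F)
        (a * ((j ^ 2 - k ^ 2) ^ 2 + j ^ 2 * k ^ 2 * (Algebra.trace F K s + 2))) =
      phi F 2 * (gaussSum (phi F) (psi p F) * ∑ x : F with x ≠ 0, phi F (a / x - x) *
        psi p F (x * (j + k) ^ 2 + (a / x) * (j - k) ^ 2)) := by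
    rw [gaussSum_mul_sum_phi_sub hq _ ha hAB,
      ← sum_phi_add_mul_kl hq hψ (d := j * k) ha (by ring),
      sum_norm_one_apply hK hq hM₈ fun y => kl (psi p F)
        (a * ((j ^ 2 - k ^ 2) ^ 2 + j ^ 2 * k ^ 2 * y)),
      ← sum_univ_mul (mul_ne_zero h2 hjk0) fun t => phi F (t + 2 * (j * k)) * _, Finset.mul_sum,
      Finset.mul_sum]
    refine Finset.sum_congr rfl fun t _ => ?_
    rw [show 2 * (j * k) * t + 2 * (j * k) = j * k * (2 * (t + 1)) by ring, map_mul _ (j * k),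
      map_mul _ 2,
      show (j - k) ^ 2 * (j + k) ^ 2 + (2 * (j * k) * t) ^ 2 =
        (j ^ 2 - k ^ 2) ^ 2 + j ^ 2 * k ^ 2 * (4 * t ^ 2) by ring]
    ring
  have hδ : (if j = k then (1 : ℂ) else 0) + phi F (-1) * (if j = -k then 1 else 0) =
      phi F (j * k) * if j ^ 2 = k ^ 2 then 1 else 0 := by
    rw [phi_neg_one hq]
    by_cases h : j = k
    · have h' : j ≠ -k := fun h' => mul_ne_zero h2 hj (by linear_combination h + h')
      rw [if_pos h, if_neg h', if_pos (by rw [h]), h, ← sq, phi_sq hk]; ring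
    · by_cases h' : j = -k
      · rw [if_neg h, if_pos h', if_pos (by rw [h', neg_sq]), h',
          show -k * k = -k ^ 2 by ring, phi_neg hq, phi_sq hk]
        ring
      · rw [if_neg h, if_neg h', if_neg fun h3 => (sq_eq_sq_iff_eq_or_eq_neg.1 h3).elim h h']
        ring
  have hprod := sum_norm_mul_sum_norm (M := M₈) hK hq hψ ha hj hk
  simp_rw [← psi_eq_psi_trace] at hprod
  have hV : τ ^ 2 * (V p M₈ τ a j * V p M₈ τ a k) = phi F (j * k) *
      ((∑ z : K with Algebra.norm F z = a, M₈ z * psi p K (algebraMap F K j ^ 2 * z)) *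
        ∑ z : K with Algebra.norm F z = a, M₈ z * psi p K (algebraMap F K k ^ 2 * z)) := by
    rw [V, V, map_mul]
    field_simp
  apply mul_left_cancel₀ (pow_ne_zero 2 hτ0)
  rw [hV, hprod, P, hδ, hτ', apply_neg_one hK hq hM₈]
  have hite : (if j ^ 2 = k ^ 2 then (Fintype.card F : ℂ) * phi F 2 else 0) =
      Fintype.card F * phi F 2 * if j ^ 2 = k ^ 2 then 1 else 0 := by
    split_ifs <;> ring
  rw [hite]
  set S := ∑ x : F with x ≠ 0, phi F (a / x - x) *
        psi p F (x * (j + k) ^ 2 + (a / x) * (j - k) ^ 2)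
  set G := gaussSum (phi F) (psi p F)
  have hcG : (Fintype.card F : ℂ) * (1 / G) = -G := by
    field_simp
    linear_combination hG
  linear_combination phi F 2 * M₈ (algebraMap F K a) * S * hcG + M₈ (algebraMap F K a) * hsum

end KatzSums

theorem mainTheorem1 (p : ℕ) [Fact p.Prime]
    {F K : Type*} [Field F] [Fintype F] [DecidableEq F] [Algebra (ZMod p) F]
    [Field K] [Fintype K] [Algebra (ZMod p) K]
    [Algebra F K] (hK : Module.finrank F K = 2)
    (hq : Fintype.card F % 4 = 3)
    (M₈ : MulChar K ℂ) (hM₈ : orderOf M₈ = 8)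
    (a : F) (ha : a ≠ 0)
    (τ : ℂ) (hτ : τ ^ 2 = (Fintype.card F : ℂ) * M₈ (algebraMap F K (-a)))
    (j k : F) :
    KatzSums.P p a j k = KatzSums.V p M₈ τ a j * KatzSums.V p M₈ τ a k := by
  exact KatzSums.P_eq_V_mul_V p hK hq M₈ hM₈ a ha τ hτ j k
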